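/- Let $M$ be a compact (connected) Riemann surface, let $P=\{p_1,\dots,p_n\}\subset M$ be a finite set of points, and let each $p_i$ be given a type: either "finite with cone angle $2\pi k_i$", for some $k_i\in\mathbb R$, or "exponential of simple type". A flat cone metric on $M$ with these cone points and types is a length element $ds$ on $M\setminus P$ such that (1) every $q\in M\setminus P$ has a neighborhood with a holomorphic coordinate $w$ in which $ds=|dw|$; (2) if $p_i$ is finite with cone angle $2\pi k_i$, there are a holomorphic coordinate $w$ near $p_i$ with $w(p_i)=0$ and a constant $c>0$ with $ds=c\,|w^{k_i-1}\,dw|$ on a punctured neighborhood of $p_i$; (3) if $p_i$ is exponential of simple type, there is a holomorphic coordinate $w$ near $p_i$ with $w(p_i)=0$ and $ds=\left|e^{1/w}\,\frac{dw}{w^2}\right|$ on a punctured neighborhood of $p_i$. Let $ds_1$ and $ds_2$ be two flat cone metrics on $M$ with the same cone points and the same types. Suppose that at each exponential cone point $p_i$ they are asymptotically isometric: there are holomorphic coordinates $z,w$ near $p_i$, vanishing at $p_i$, with $ds_1=\left|e^{1/z}\,\frac{dz}{z^2}\right|$ and $ds_2=\left|e^{1/w}\,\frac{dw}{w^2}\right|$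 on a punctured neighborhood of $p_i$ and $\frac{dw}{dz}(0)=1$. (If all cone angles are finite, this is no condition.) Then there is a constant $c>0$ such that $ds_2=c\,ds_1$ on $M\setminus P$. -/

import Mathlib

open scoped Manifold ContDiff

noncomputable section

namespace ConeMetric

/-- The possible kinds of cone points: `finite k` is a cone point with (finite) cone angle `2πk`,
where `k` is an arbitrary real number, modelled on the cone `C_k`; `exponential` is an exponential
cone point of simple type, modelled on `C_e`. -/
inductive ConeType where
  | finite (k : ℝ) : ConeType
  | exponential : ConeType

section

variable (M : Type*) [TopologicalSpace M] [ChartedSpace ℂ M]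

/-- A (not yet restricted) length element `ds` on a Riemann surface: the length `ds q v` of each
tangent vector `v` at each point `q`. The predicates below only ever constrain it away from the
cone points, its values at the cone points being irrelevant. -/
abbrev LengthElement : Type _ := ∀ q : M, TangentSpace 𝓘(ℂ) q → ℝ

end

section

variable {M : Type*} [TopologicalSpace M] [ChartedSpace ℂ M]

/-- The norm `|dw_q(v)|` of the differential at `q` of a local coordinate `w`, applied to a tangent
vector `v` at `q`. -/
def absDiff (w : OpenPartialHomeomorph M ℂ) (q : M) (v : TangentSpace 𝓘(ℂ) q) : ℝ :=
  norm (E := ℂ) (mfderiv 𝓘(ℂ) 𝓘(ℂ) w q v)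

/-- `w` is a local holomorphic coordinate of the Riemann surface `M`, centred at `p`. -/
def IsCentredCoordinate (p : M) (w : OpenPartialHomeomorph M ℂ) : Prop :=
  w ∈ IsManifold.maximalAtlas 𝓘(ℂ) ω M ∧ p ∈ w.source ∧ w p = 0

/-- In the coordinate `w`, centred at `p`, the length element is that of the Euclidean plane,
`ds = |dw|`. -/
def IsEuclideanCoordinate (ds : LengthElement M) (p : M) (w : OpenPartialHomeomorph M ℂ) : Prop :=
  IsCentredCoordinate p w ∧ ∀ q ∈ w.source, ∀ v : TangentSpace 𝓘(ℂ) q, ds q v = absDiff w q v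

/-- In the coordinate `w`, centred at `p`, the length element is, away from `p`, that of the model
cone of the given type: `|w ^ (k - 1) dw|` up to scaling for `C_k`, and
`|e ^ (1 / w) dw / w ^ 2|` for `C_e`. -/
def IsConeCoordinate (ds : LengthElement M) (p : M) :
    ConeType → OpenPartialHomeomorph M ℂ → Prop
  | .finite k, w => IsCentredCoordinate p w ∧ ∃ c : ℝ, 0 < c ∧
      ∀ q ∈ w.source, q ≠ p → ∀ v : TangentSpace 𝓘(ℂ) q,
        ds q v = c * (‖w q‖ ^ (k - 1) * absDiff w q v)
  | .exponential, w => IsCentredCoordinate p w ∧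
      ∀ q ∈ w.source, q ≠ p → ∀ v : TangentSpace 𝓘(ℂ) q,
        ds q v = ‖Complex.exp (1 / w q) / w q ^ 2‖ * absDiff w q v

/-- `ds` is a flat cone metric on the Riemann surface `M`, compatible with its complex structure,
whose cone points are the points of `P`, the cone point `p ∈ P` being of type `τ p`: every point
outside `P` has a neighbourhood isometric to an open set of the Euclidean plane, and every `p ∈ P`
has a neighbourhood isometric to a neighbourhood of the vertex of the model cone of type `τ p`.
(Trivial cone points, with `k = 1`, are allowed.) -/
structure IsFlatConeMetric (ds : LengthElement M) (P : Finset M) (τ : P → ConeType) : Prop where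
  regular : ∀ p, p ∉ P → ∃ w, IsEuclideanCoordinate ds p w
  cone : ∀ p : P, ∃ w, IsConeCoordinate ds p (τ p) w

/-- The exponential cone points at `p` of `ds₁` and `ds₂` are asymptotically isometric: there are
coordinates `z` and `w` centred at `p` in which `ds₁ = |e ^ (1 / z) dz / z ^ 2|` and
`ds₂ = |e ^ (1 / w) dw / w ^ 2|` and for which `dw / dz = 1` at `z = 0`. -/
def AsymptoticallyIsometric (ds₁ ds₂ : LengthElement M) (p : M) : Prop :=
  ∃ z w : OpenPartialHomeomorph M ℂ,
    IsConeCoordinate ds₁ p .exponential z ∧ IsConeCoordinate ds₂ p .exponential w ∧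
      HasDerivAt (w ∘ z.symm) 1 0

end

end ConeMetric

end

namespace ConeMetric

open Filter Topology

/-! The ratio of the two metrics is locally the modulus of a nonvanishing holomorphic function, even
across cone points (`exists_ratio_eq_norm`). At a finite cone point the powers of `|z|` cancel. At
an exponential one, `dw/dz = 1` makes `1/w - 1/z` holomorphic, so the essential singularities
cancel. The ratio thus extends continuously to the compact surface, attains its maximum, and is
constant by the maximum principle (`eq_of_eventually_eq_norm`). -/

theorem analyticAt_dslope {f : ℂ → ℂ} {a : ℂ} (hf : AnalyticAt ℂ f a) :
    AnalyticAt ℂ (dslope f a) a := by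
  have hs : {x | DifferentiableAt ℂ f x} ∈ 𝓝 a :=
    hf.eventually_analyticAt.mono fun x hx => hx.differentiableAt
  exact ((Complex.differentiableOn_dslope hs).2
    fun x hx => DifferentiableAt.differentiableWithinAt hx).analyticAt hs

theorem eq_add_mul_dslope (f : ℂ → ℂ) (x : ℂ) : f x = f 0 + x * dslope f 0 x := by
  have h := sub_smul_dslope f 0 x
  rw [sub_zero, smul_eq_mul] at h
  rw [h]; ring

/-- If `w = h(z)` is a change of coordinate fixing `0`, the length elements `|w ^ a dw|` and
`|z ^ a dz|` differ by the modulus of a nonvanishing holomorphic function. -/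
theorem exists_analyticAt_norm_rpow_mul_deriv {h : ℂ → ℂ} (hh : AnalyticAt ℂ h 0)
    (h0 : h 0 = 0) (hd : deriv h 0 ≠ 0) {c : ℝ} (hc : 0 < c) (a : ℝ) :
    ∃ g : ℂ → ℂ, AnalyticAt ℂ g 0 ∧ g 0 ≠ 0 ∧
      ∀ x, x ≠ 0 → c * (‖h x‖ ^ a * ‖deriv h x‖) = ‖g x‖ * ‖x‖ ^ a := by
  set k := dslope h 0 with hk
  set b := deriv h 0 with hb
  have hk0 : k 0 = b := dslope_same h 0
  have hka : AnalyticAt ℂ k 0 := analyticAt_dslope hh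
  have hkb : ‖b‖ ^ a ≠ 0 := (Real.rpow_pos_of_pos (norm_pos_iff.2 hd) a).ne'
  -- Dividing by `b` makes the base equal to `1` at `0`, inside the slit plane where `cpow` is
  -- analytic; the factor `‖b‖ ^ a` restores the modulus.
  refine ⟨fun x => ((c * ‖b‖ ^ a : ℝ) : ℂ) * (k x / b) ^ (a : ℂ) * deriv h x, ?_, ?_, ?_⟩
  · refine (analyticAt_const.mul ((hka.div analyticAt_const hd).cpow analyticAt_const ?_)).mul
      hh.deriv
    simp [hk0, hd]
  · simp [hk0, hd, hkb, hc.ne', ← hb]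
  · intro x _
    have hx : h x = x * k x := by simpa [h0] using eq_add_mul_dslope h x
    simp only [norm_mul, Complex.norm_real, Complex.norm_cpow_real, norm_div]
    rw [Real.norm_of_nonneg hc.le, Real.norm_of_nonneg (show 0 ≤ ‖b‖ ^ a by positivity), hx, norm_mul, Real.mul_rpow (by positivity)
      (by positivity), Real.div_rpow (by positivity) (by positivity)]
    field_simp

/-- If `w = h(z)` is a change of coordinate tangent to the identity at `0`, the length elements
`|e ^ (1 / w) dw / w ^ 2|` and `|e ^ (1 / z) dz / z ^ 2|` differ by the modulus of a nonvanishing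
holomorphic function. -/
theorem exists_analyticAt_norm_exp_mul_deriv {h : ℂ → ℂ} (hh : AnalyticAt ℂ h 0)
    (h0 : h 0 = 0) (hd : deriv h 0 = 1) :
    ∃ g : ℂ → ℂ, AnalyticAt ℂ g 0 ∧ g 0 ≠ 0 ∧ ∀ᶠ x in 𝓝 0, x ≠ 0 →
      ‖Complex.exp (1 / h x) / h x ^ 2‖ * ‖deriv h x‖ =
        ‖g x‖ * ‖Complex.exp (1 / x) / x ^ 2‖ := by
  set k := dslope h 0 with hk
  set m := dslope k 0 with hm
  have hk0 : k 0 = 1 := (dslope_same h 0).trans hd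
  have hka : AnalyticAt ℂ k 0 := analyticAt_dslope hh
  have hma : AnalyticAt ℂ m 0 := analyticAt_dslope hka
  -- Since `h = x * k` and `k = 1 + x * m`, the poles cancel: `1 / h - 1 / x = -m / k`.
  refine ⟨fun x => Complex.exp (-m x / k x) / k x ^ 2 * deriv h x, ?_, ?_, ?_⟩
  · exact (((hma.neg.div hka (by simp [hk0])).cexp).div (hka.pow 2) (by simp [hk0])).mul hh.deriv
  · simp [hk0, hd]
  · have hne : ∀ᶠ x in 𝓝 0, k x ≠ 0 := hka.continuousAt.eventually_ne (by simp [hk0])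
    filter_upwards [hne] with x hkx hx
    have h1 : h x = x * k x := by simpa [h0] using eq_add_mul_dslope h x
    have h2 : k x = 1 + x * m x := by simpa [hk0] using eq_add_mul_dslope k x
    have h3 : 1 / h x = -m x / k x + 1 / x := by
      rw [h1]
      field_simp
      linear_combination -h2
    rw [← norm_mul, ← norm_mul, h3, Complex.exp_add, h1]
    congr 1
    field_simp

section

variable {M : Type*} [TopologicalSpace M] [ChartedSpace ℂ M]

theorem IsCentredCoordinate.absDiff_pos {p : M} {z : OpenPartialHomeomorph M ℂ}
    (hz : IsCentredCoordinate p z) {q : M} (hq : q ∈ z.source) {v : TangentSpace 𝓘(ℂ) q}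
    (hv : v ≠ 0) : 0 < absDiff z q v := by
  have hd : z.MDifferentiable 𝓘(ℂ) 𝓘(ℂ) :=
    ⟨(contMDiffOn_of_mem_maximalAtlas hz.1).mdifferentiableOn (by simp),
      (contMDiffOn_symm_of_mem_maximalAtlas hz.1).mdifferentiableOn (by simp)⟩
  refine norm_pos_iff.2 fun h => hv (hd.mfderiv_injective hq ?_)
  rw [map_zero]
  exact h

theorem IsCentredCoordinate.eventually_mem_source {p : M} {z : OpenPartialHomeomorph M ℂ}
    (hz : IsCentredCoordinate p z) : ∀ᶠ q in 𝓝 p, q ∈ z.source :=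
  z.open_source.mem_nhds hz.2.1

theorem IsCentredCoordinate.tendsto {p : M} {z : OpenPartialHomeomorph M ℂ}
    (hz : IsCentredCoordinate p z) : Tendsto z (𝓝 p) (𝓝 0) := by
  have h := z.continuousAt hz.2.1
  rwa [ContinuousAt, hz.2.2] at h

theorem IsCentredCoordinate.ne_zero {p : M} {z : OpenPartialHomeomorph M ℂ}
    (hz : IsCentredCoordinate p z) {q : M} (hq : q ∈ z.source) (hqp : q ≠ p) : z q ≠ 0 :=
  fun h => hqp (z.injOn hq hz.2.1 (h.trans hz.2.2.symm))

variable {p : M} {z w : OpenPartialHomeomorph M ℂ}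

theorem IsCentredCoordinate.transition_zero (hz : IsCentredCoordinate p z)
    (hw : IsCentredCoordinate p w) : (w ∘ z.symm) 0 = 0 := by
  have hp : z.symm 0 = p := by rw [← hz.2.2, z.left_inv hz.2.1]
  rw [Function.comp_apply, hp, hw.2.2]

theorem IsCentredCoordinate.analyticAt_transition (hz : IsCentredCoordinate p z)
    (hw : IsCentredCoordinate p w) : AnalyticAt ℂ (w ∘ z.symm) 0 := by
  have hz0 : (0 : ℂ) ∈ z.target := hz.2.2 ▸ z.map_source hz.2.1
  have hp : z.symm 0 = p := by rw [← hz.2.2, z.left_inv hz.2.1]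
  have h1 : ContMDiffAt 𝓘(ℂ) 𝓘(ℂ) ω z.symm 0 :=
    contMDiffAt_symm_of_mem_maximalAtlas hz.1 hz0
  have h2 : ContMDiffAt 𝓘(ℂ) 𝓘(ℂ) ω w (z.symm 0) :=
    contMDiffAt_of_mem_maximalAtlas hw.1 (by rw [hp]; exact hw.2.1)
  exact (contMDiffAt_iff_contDiffAt.1 (h2.comp 0 h1)).analyticAt

theorem IsCentredCoordinate.eventually_absDiff_eq (hz : IsCentredCoordinate p z)
    (hw : IsCentredCoordinate p w) :
    ∀ᶠ q in 𝓝 p, ∀ v : TangentSpace 𝓘(ℂ) q,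
      absDiff w q v = ‖deriv (w ∘ z.symm) (z q)‖ * absDiff z q v := by
  filter_upwards [hz.eventually_mem_source,
    hz.tendsto.eventually (hz.analyticAt_transition hw).eventually_analyticAt] with q hq hqa v
  have h1 : (w : M → ℂ) =ᶠ[𝓝 q] (w ∘ z.symm) ∘ z := by
    filter_upwards [z.open_source.mem_nhds hq] with r hr
    simp [z.left_inv hr]
  have h2 : MDifferentiableAt 𝓘(ℂ) 𝓘(ℂ) z q :=
    (contMDiffAt_of_mem_maximalAtlas hz.1 hq).mdifferentiableAt (by simp)
  have h3 : mfderiv 𝓘(ℂ) 𝓘(ℂ) w q v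
      = deriv (w ∘ z.symm) (z q) * (show ℂ from mfderiv 𝓘(ℂ) 𝓘(ℂ) z q v) := by
    rw [h1.mfderiv_eq, mfderiv_comp q hqa.differentiableAt.mdifferentiableAt h2,
      mfderiv_eq_fderiv]
    exact fderiv_eq_deriv_mul (𝕜 := ℂ)
  exact (congrArg (norm (E := ℂ)) h3).trans (norm_mul _ _)

/-- Otherwise the differential of `w` would kill every tangent vector at `p`, but the differential
of a chart is injective. -/
theorem IsCentredCoordinate.deriv_transition_ne_zero (hz : IsCentredCoordinate p z)
    (hw : IsCentredCoordinate p w) : deriv (w ∘ z.symm) 0 ≠ 0 := by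
  intro h
  have h1 := (hz.eventually_absDiff_eq hw).self_of_nhds (1 : ℂ)
  have h2 := hw.absDiff_pos hw.2.1 (v := (1 : ℂ)) (one_ne_zero (α := ℂ))
  rw [hz.2.2, h, norm_zero, zero_mul] at h1
  exact h2.ne' h1

/-- Near `p`, and away from `p` if `p` is a cone point, the ratio of two flat cone metrics is the
modulus of a holomorphic function, which does not vanish at `p`. -/
theorem IsFlatConeMetric.exists_ratio_eq_norm {P : Finset M} {τ : P → ConeType}
    {ds₁ ds₂ : LengthElement M} (h₁ : IsFlatConeMetric ds₁ P τ) (h₂ : IsFlatConeMetric ds₂ P τ)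
    (hexp : ∀ p : P, τ p = .exponential → AsymptoticallyIsometric ds₁ ds₂ p) (p : M) :
    ∃ (z : OpenPartialHomeomorph M ℂ) (g : ℂ → ℂ), IsCentredCoordinate p z ∧
      AnalyticAt ℂ g 0 ∧ g 0 ≠ 0 ∧ ∀ᶠ q in 𝓝 p, (p ∈ P → q ≠ p) →
        ∀ v : TangentSpace 𝓘(ℂ) q, ds₂ q v = ‖g (z q)‖ * ds₁ q v := by
  by_cases hp : p ∈ P
  · cases hτ : τ ⟨p, hp⟩ with
    | finite k =>
      obtain ⟨z, hz⟩ := h₁.cone ⟨p, hp⟩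
      obtain ⟨w, hw⟩ := h₂.cone ⟨p, hp⟩
      rw [hτ] at hz hw
      obtain ⟨hz, c, hc, hzc⟩ := hz
      obtain ⟨hw, d, hd, hwd⟩ := hw
      obtain ⟨g, hga, hg0, hg⟩ := exists_analyticAt_norm_rpow_mul_deriv
        (hz.analyticAt_transition hw) (hz.transition_zero hw) (hz.deriv_transition_ne_zero hw)
        (div_pos hd hc) (k - 1)
      refine ⟨z, g, hz, hga, hg0, ?_⟩
      filter_upwards [hz.eventually_absDiff_eq hw, hz.eventually_mem_source,
        hw.eventually_mem_source] with q hq hqz hqw hqp v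
      have h := hg (z q) (hz.ne_zero hqz (hqp hp))
      rw [Function.comp_apply, z.left_inv hqz] at h
      rw [hzc q hqz (hqp hp), hwd q hqw (hqp hp), hq]
      field_simp at h
      linear_combination absDiff z q v * h
    | exponential =>
      obtain ⟨z, w, ⟨hz, hze⟩, ⟨hw, hwe⟩, hzw⟩ := hexp ⟨p, hp⟩ hτ
      obtain ⟨g, hga, hg0, hg⟩ := exists_analyticAt_norm_exp_mul_deriv
        (hz.analyticAt_transition hw) (hz.transition_zero hw) hzw.deriv
      refine ⟨z, g, hz, hga, hg0, ?_⟩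
      filter_upwards [hz.eventually_absDiff_eq hw, hz.eventually_mem_source,
        hw.eventually_mem_source, hz.tendsto.eventually hg] with q hq hqz hqw h hqp v
      replace h := h (hz.ne_zero hqz (hqp hp))
      rw [Function.comp_apply, z.left_inv hqz] at h
      rw [hze q hqz (hqp hp), hwe q hqw (hqp hp), hq]
      linear_combination absDiff z q v * h
  · obtain ⟨z, hz, hze⟩ := h₁.regular p hp
    obtain ⟨w, hw, hwe⟩ := h₂.regular p hp
    refine ⟨z, deriv (w ∘ z.symm), hz, (hz.analyticAt_transition hw).deriv,
      hz.deriv_transition_ne_zero hw, ?_⟩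
    filter_upwards [hz.eventually_absDiff_eq hw, hz.eventually_mem_source,
      hw.eventually_mem_source] with q hq hqz hqw _ v
    rw [hze q hqz, hwe q hqw, hq]

theorem IsFlatConeMetric.pos {P : Finset M} {τ : P → ConeType} {ds : LengthElement M}
    (h : IsFlatConeMetric ds P τ) {q : M} (hq : q ∉ P) {v : TangentSpace 𝓘(ℂ) q} (hv : v ≠ 0) :
    0 < ds q v := by
  obtain ⟨z, hz, hze⟩ := h.regular q hq
  rw [hze q hz.2.1]
  exact hz.absDiff_pos hz.2.1 hv

/-- A real function on a compact connected Riemann surface which is locally the modulus of a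
holomorphic function is constant. -/
theorem eq_of_eventually_eq_norm [CompactSpace M] [ConnectedSpace M] {F : M → ℝ}
    (hF : ∀ p, ∃ (z : OpenPartialHomeomorph M ℂ) (g : ℂ → ℂ), IsCentredCoordinate p z ∧
      AnalyticAt ℂ g 0 ∧ ∀ᶠ q in 𝓝 p, F q = ‖g (z q)‖) (p q : M) : F q = F p := by
  have hcont : Continuous F := by
    refine continuous_iff_continuousAt.2 fun p => ?_
    obtain ⟨z, g, hz, hg, h⟩ := hF p
    refine ContinuousAt.congr (ContinuousAt.norm ?_) (h.mono fun q hq => hq.symm)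
    refine ContinuousAt.comp (g := g) ?_ (z.continuousAt hz.2.1)
    rw [hz.2.2]
    exact hg.continuousAt
  obtain ⟨m, -, hm⟩ := isCompact_univ.exists_isMaxOn Set.univ_nonempty hcont.continuousOn
  have hmax : ∀ r, F r ≤ F m := fun r => hm (Set.mem_univ r)
  -- By the maximum modulus principle, `F` is constant near any point where it attains its maximum.
  have hopen : IsOpen {r | F r = F m} := by
    refine isOpen_iff_mem_nhds.2 fun r hr => ?_
    obtain ⟨z, g, hz, hg, h⟩ := hF r
    have hr0 : ‖g 0‖ = F m := by rw [← hz.2.2, ← h.self_of_nhds, hr]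
    have hloc : IsLocalMax (norm ∘ g) 0 := by
      have hs : Tendsto z.symm (𝓝 0) (𝓝 r) := by
        have := z.tendsto_symm hz.2.1
        rwa [hz.2.2] at this
      filter_upwards [hs.eventually h,
        z.open_target.mem_nhds (hz.2.2 ▸ z.map_source hz.2.1 : (0 : ℂ) ∈ z.target)] with x hx hxt
      rw [z.right_inv hxt] at hx
      simpa only [Function.comp_apply, ← hx, hr0] using hmax (z.symm x)
    have hconst := Complex.norm_eventually_eq_of_isLocalMax
      (hg.eventually_analyticAt.mono fun x hx => hx.differentiableAt) hloc
    filter_upwards [h, hz.tendsto.eventually hconst] with s hs hs'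
    exact hs.trans (hs'.trans hr0)
  have huniv := IsClopen.eq_univ ⟨isClosed_eq hcont continuous_const, hopen⟩ ⟨m, rfl⟩
  have hall : ∀ r, F r = F m := fun r => by
    have : r ∈ {r | F r = F m} := huniv ▸ Set.mem_univ r
    exact this
  rw [hall p, hall q]

end

end ConeMetric

theorem proposition4 {M : Type*} [TopologicalSpace M] [T2Space M] [CompactSpace M]
    [ConnectedSpace M] [ChartedSpace ℂ M] [IsManifold 𝓘(ℂ) ω M]
    (P : Finset M) (τ : P → ConeMetric.ConeType)
    (ds₁ ds₂ : ConeMetric.LengthElement M)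
    (h₁ : ConeMetric.IsFlatConeMetric ds₁ P τ) (h₂ : ConeMetric.IsFlatConeMetric ds₂ P τ)
    (hexp : ∀ p : P, τ p = ConeMetric.ConeType.exponential →
      ConeMetric.AsymptoticallyIsometric ds₁ ds₂ p) :
    ∃ c : ℝ, 0 < c ∧ ∀ q : M, q ∉ P → ∀ v : TangentSpace 𝓘(ℂ) q,
      ds₂ q v = c * ds₁ q v := by
  choose z g hz hga hg0 hg using h₁.exists_ratio_eq_norm h₂ hexp
  have hself : ∀ q, q ∉ P → ∀ v : TangentSpace 𝓘(ℂ) q, ds₂ q v = ‖g q 0‖ * ds₁ q v := by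
    intro q hq v
    have h := (hg q).self_of_nhds (fun h => absurd h hq) v
    rwa [(hz q).2.2] at h
  -- The value at the centre of each local function defines the ratio at cone points too, where the
  -- lengths themselves carry no information.
  have hconst := ConeMetric.eq_of_eventually_eq_norm (F := fun p => ‖g p 0‖)
    fun p => by
      refine ⟨z p, g p, hz p, hga p, ?_⟩
      -- Near `p` there is no other cone point, so at `q ≠ p` the functions centred at `p` and at
      -- `q` both compute the ratio of the metrics.
      have hP : ∀ᶠ q in nhds p, q ∉ (P : Set M) \ {p} :=
        (P.finite_toSet.sdiff).isClosed.isOpen_compl.mem_nhds (by simp)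
      filter_upwards [hg p, hP] with q hq hqP
      by_cases hqp : q = p
      · rw [hqp, (hz p).2.2]
      · have hqP' : q ∉ P := fun h => hqP ⟨h, hqp⟩
        have h := (hself q hqP' (1 : ℂ)).symm.trans (hq (fun _ => hqp) (1 : ℂ))
        exact mul_right_cancel₀ (h₁.pos hqP' (v := (1 : ℂ)) (one_ne_zero (α := ℂ))).ne' h
  obtain ⟨p⟩ : Nonempty M := inferInstance
  refine ⟨‖g p 0‖, norm_pos_iff.2 (hg0 p), fun q hq v => ?_⟩
  rw [hself q hq v, hconst p q]
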